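/- For $0<\eta<2\pi$ let $$W_\eta=\{(r\cos\theta,r\sin\theta):\ r>0,\ -\tfrac{\eta}{2}<\theta<\tfrac{\eta}{2}\}\subset\mathbb R^2 ,$$ and for $1<p<\infty$ let $$\Delta_p u=\frac1p\,|\nabla u|^{2-p}\,\operatorname{div}\bigl(|\nabla u|^{p-2}\nabla u\bigr)$$ be the game $p$-Laplacian. **Theorem 1.2.** Let $1<p<\infty$ and $$0<\eta<\pi\left[1-\frac12\sqrt{\frac{2(p-1)}{p}}\,\right].$$ Then the boundary value problem $$\Delta_p u=-1\ \text{ in } W_\eta,\qquad u=0\ \text{ on }\partial W_\eta,$$ has a nonnegative solution $u\in C^3(\overline{W_\eta}\setminus\{0\})\cap C(\overline{W_\eta})$ of the form $u=r^2f(\theta)$ in polar coordinates. Moreover, $u>0$ on $W_\eta$ and $|\nabla u|\neq0$ on $\overline{W_\eta}\setminus\{0\}$. Here $u\in C^3(\overline{W_\eta}\setminus\{0\})$ means that $u$ has a $C^3$ extension to an open set containing $\overline{W_\eta}\setminus\{0\}$, and $\nabla u$ at points of $\partial W_\eta\setminus\{0\}$ is the gradient of such an extension (it does not depend on the extension). 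-/

import Mathlib

/-- The open wedge in the plane with vertex at the origin and opening angle `η`, symmetric about
the positive first coordinate axis: in polar coordinates, `r > 0` and `-η/2 < θ < η/2`. -/
def wedge (η : ℝ) : Set (EuclideanSpace ℝ (Fin 2)) :=
  {x | ∃ r θ : ℝ, 0 < r ∧ -(η / 2) < θ ∧ θ < η / 2 ∧ x = !₂[r * Real.cos θ, r * Real.sin θ]}

/-- The divergence of a vector field on `ℝᵈ`. -/
noncomputable def divergence {d : ℕ}
    (F : EuclideanSpace ℝ (Fin d) → EuclideanSpace ℝ (Fin d)) (x : EuclideanSpace ℝ (Fin d)) : ℝ :=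
  ∑ i, fderiv ℝ (fun y => F y i) x (EuclideanSpace.single i 1)

/-- The game `p`-Laplacian `Δ_p u = (1/p) |∇u|^(2-p) div(|∇u|^(p-2) ∇u)`. It is the classical
expression wherever `u` is twice differentiable near a point with non-vanishing gradient. -/
noncomputable def gamePLaplacian {d : ℕ} (p : ℝ)
    (u : EuclideanSpace ℝ (Fin d) → ℝ) (x : EuclideanSpace ℝ (Fin d)) : ℝ :=
  1 / p * ‖gradient u x‖ ^ (2 - p) *
    divergence (fun y => ‖gradient u y‖ ^ (p - 2) • gradient u y) x

/-- `u ∈ Cᵏ(S)` for a set `S` that need not be open: the restriction of `u` to `S` has a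
`Cᵏ` extension to an open set containing `S`. -/
def ExtendsContDiff {d : ℕ} (k : ℕ) (u : EuclideanSpace ℝ (Fin d) → ℝ)
    (S : Set (EuclideanSpace ℝ (Fin d))) : Prop :=
  ∃ (U : Set (EuclideanSpace ℝ (Fin d))) (v : EuclideanSpace ℝ (Fin d) → ℝ),
    IsOpen U ∧ S ⊆ U ∧ ContDiffOn ℝ k v U ∧ Set.EqOn u v S

/-!
In polar coordinates write `u = r² f(θ)`. The gradient has radial part `2 r f` and angular part
`r f'`; with `2 f = exp (-z) cos φ` and `f' = -exp (-z) sin φ` its length is `r exp (-z)` and `φ` is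
its angle with the radial direction. In these variables the equation `Δ_p u = -1` is the autonomous
system

  `D φ' = p cos² φ + 2 (p - 1) sin² φ + p cos φ exp z`,
  `D z' = -sin φ ((p - 2) cos φ + p exp z)`,   `D = cos² φ + (p - 1) sin² φ`,

which has no singularities, since `D > 0` for `p > 1`. In particular the gradient never vanishes
away from the vertex. An even, positive profile `f` vanishing at `±η/2` is a solution with
`φ(0) = 0` and `φ(η/2) = π/2`, and it is found by shooting in the initial value of `z`
(`exists_phaseCurve_eq_pi_div_two`).

* As `exp (z 0) → 0` the term `exp z` disappears from the first equation, and `φ` reaches `π/2` at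
  `∫₀^{π/2} D / (p cos² + 2 (p - 1) sin²)`, which is half the critical angle; so at the time `η/2`
  the phase is still below `π/2` (`IsPhaseCurve.lt_pi_div_two`).
* `cos φ · exp (-z)` decreases, hence `φ' ≥ 1 + exp (z 0) cos² φ`, and `φ` reaches `π/2` no later
  than `π / (2 √(1 + exp (z 0)))`, which is small when `z 0` is large
  (`IsPhaseCurve.pi_div_two_le_of_large`).

The phase at the time `η/2` depends continuously on `z 0` (`exists_phaseCurve_family`), so it equals
`π/2` for some initial value. Both time integrals are evaluated with `trigPrimitive`. The solution
continues smoothly past `η/2`, which gives the smooth extension of `u` across the sides of the wedge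
(`exists_phaseSolution`). As `η < π`, the closed wedge without its vertex lies in the right
half-plane, where the polar angle is `arctan (x₁ / x₀)`, and the equation is verified there in
Cartesian coordinates (`IsPhaseSolution.gamePLaplacian_eq`).
-/

open Set Filter Topology

/-! ### Flows of bounded Lipschitz vector fields -/

/-- A bounded Lipschitz vector field has a flow, continuous in the initial point, on every time
interval `[-T, T]` and every ball of initial points. -/
theorem exists_flow_of_lipschitz_of_bounded {E : Type*} [NormedAddCommGroup E] [NormedSpace ℝ E]
    [CompleteSpace E] {X : E → E} {K L : NNReal} (hK : LipschitzWith K X) (hL : ∀ x, ‖X x‖ ≤ L)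
    (x₀ : E) (r : NNReal) {T : ℝ} (hT : 0 ≤ T) :
    ∃ α : E → ℝ → E, (∀ x ∈ Metric.closedBall x₀ r, α x 0 = x ∧
      ∀ t ∈ Icc (-T) T, HasDerivWithinAt (α x) (X (α x t)) (Icc (-T) T) t) ∧
      ∀ t ∈ Icc (-T) T, ContinuousOn (α · t) (Metric.closedBall x₀ r) := by
  lift T to NNReal using hT
  have hpl : IsPicardLindelof (fun _ => X) (tmin := -T) (tmax := T) ⟨0, by simp⟩ x₀
      (r + L * T) r L K := by
    refine IsPicardLindelof.of_time_independent (fun x _ => hL x) hK.lipschitzOnWith ?_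
    simp
  obtain ⟨α, hα, L', hL'⟩ :=
    hpl.exists_forall_mem_closedBall_eq_hasDerivWithinAt_lipschitzOnWith
  exact ⟨α, hα, fun t ht => (hL' t ht).continuousOn⟩

/-- Truncation of a real number to the interval `[a, b]`. -/
noncomputable def truncate (a b x : ℝ) : ℝ := max a (min b x)

theorem truncate_mem {a b : ℝ} (h : a ≤ b) (x : ℝ) : truncate a b x ∈ Icc a b :=
  ⟨le_max_left _ _, max_le h (min_le_left _ _)⟩

theorem truncate_of_mem {a b x : ℝ} (h : x ∈ Icc a b) : truncate a b x = x := by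
  rw [truncate, min_eq_right h.2, max_eq_right h.1]

theorem truncate_neg {a : ℝ} (ha : 0 ≤ a) (x : ℝ) :
    truncate (-a) a (-x) = -truncate (-a) a x := by
  unfold truncate
  grind

theorem lipschitzWith_truncate (a b : ℝ) : LipschitzWith 1 (truncate a b) :=
  (LipschitzWith.id.const_min b).const_max a

/-- A `C¹` vector field on the plane, evaluated at the truncation of a point to a box, is bounded
and globally Lipschitz. -/
theorem exists_lipschitz_bounded_truncate {X : ℝ × ℝ → ℝ × ℝ} (hX : ContDiff ℝ 1 X)
    {a b c d : ℝ} (hab : a ≤ b) (hcd : c ≤ d) :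
    ∃ K L : NNReal, LipschitzWith K (fun q : ℝ × ℝ => X (truncate a b q.1, truncate c d q.2)) ∧
      ∀ q : ℝ × ℝ, ‖X (truncate a b q.1, truncate c d q.2)‖ ≤ L := by
  have hc : IsCompact (Icc a b ×ˢ Icc c d) := isCompact_Icc.prod isCompact_Icc
  obtain ⟨K, hK⟩ := hX.locallyLipschitz.locallyLipschitzOn.exists_lipschitzOnWith_of_compact hc
  obtain ⟨C, hC⟩ := hc.exists_bound_of_continuousOn hX.continuous.continuousOn
  have hm : ∀ q : ℝ × ℝ, (truncate a b q.1, truncate c d q.2) ∈ Icc a b ×ˢ Icc c d :=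
    fun q => ⟨truncate_mem hab _, truncate_mem hcd _⟩
  have hl : LipschitzWith 1 (fun q : ℝ × ℝ => (truncate a b q.1, truncate c d q.2)) := by
    have := ((lipschitzWith_truncate a b).comp LipschitzWith.prod_fst).prodMk
      ((lipschitzWith_truncate c d).comp LipschitzWith.prod_snd)
    simpa using! this
  refine ⟨K * 1, C.toNNReal, ?_, fun q => (hC _ (hm q)).trans (Real.le_coe_toNNReal C)⟩
  exact lipschitzOnWith_univ.mp (hK.comp hl.lipschitzOnWith (fun q _ => hm q))

/-! ### The integral of the reciprocal of a quadratic form in sine and cosine -/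

/-- The antiderivative of `1 / (α cos² + β sin²)` vanishing at `0`. On `(-π/2, π/2)` it equals
`arctan (√(β/α) tan x) / √(α β)`; the form used here is smooth on the whole line. -/
noncomputable def trigPrimitive (α β x : ℝ) : ℝ :=
  (x + Real.arctan ((√(β / α) - 1) * (Real.sin x * Real.cos x) /
    (Real.cos x ^ 2 + √(β / α) * Real.sin x ^ 2))) / √(α * β)

theorem trigPrimitive_zero (α β : ℝ) : trigPrimitive α β 0 = 0 := by
  simp [trigPrimitive]

theorem trigPrimitive_pi_div_two (α β : ℝ) :
    trigPrimitive α β (Real.pi / 2) = Real.pi / 2 / √(α * β) := by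
  simp [trigPrimitive]

theorem cos_sq_add_mul_sin_sq_pos {α β : ℝ} (hα : 0 < α) (hβ : 0 < β) (x : ℝ) :
    0 < α * Real.cos x ^ 2 + β * Real.sin x ^ 2 := by
  have h := Real.sin_sq_add_cos_sq x
  rcases le_total α β with hab | hab <;>
    nlinarith [sq_nonneg (Real.cos x), sq_nonneg (Real.sin x)]

theorem hasDerivAt_trigPrimitive {α β : ℝ} (hα : 0 < α) (hβ : 0 < β) (x : ℝ) :
    HasDerivAt (trigPrimitive α β)
      (1 / (α * Real.cos x ^ 2 + β * Real.sin x ^ 2)) x := by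
  obtain ⟨k, hk, rfl⟩ : ∃ k, 0 < k ∧ β = α * k ^ 2 :=
    ⟨√(β / α), Real.sqrt_pos.mpr (by positivity), by
      rw [Real.sq_sqrt (by positivity)]; field_simp⟩
  have h1 : √(α * k ^ 2 / α) = k := by
    rw [mul_div_cancel_left₀ _ hα.ne', Real.sqrt_sq hk.le]
  have h2 : √(α * (α * k ^ 2)) = α * k := by
    rw [show α * (α * k ^ 2) = (α * k) ^ 2 by ring, Real.sqrt_sq (by positivity)]
  have hsc := Real.sin_sq_add_cos_sq x
  have hpos : 0 < Real.cos x ^ 2 + k * Real.sin x ^ 2 := by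
    simpa using cos_sq_add_mul_sin_sq_pos one_pos hk x
  have hpos2 : 0 < Real.cos x ^ 2 + k ^ 2 * Real.sin x ^ 2 := by
    simpa using cos_sq_add_mul_sin_sq_pos one_pos (pow_pos hk 2) x
  have hnum := ((Real.hasDerivAt_sin x).mul (Real.hasDerivAt_cos x)).const_mul (k - 1)
  have hden := ((Real.hasDerivAt_cos x).pow 2).add
    (((Real.hasDerivAt_sin x).pow 2).const_mul k)
  have hd := (((hasDerivAt_id x).add (hnum.div hden hpos.ne').arctan).div_const (α * k))
  unfold trigPrimitive
  rw [h1, h2]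
  refine (hd.congr_deriv ?_)
  -- `(c² + k s²)² + (k - 1)² s² c² = c² + k² s²`, because `s² + c² = 1`
  have key : (Real.cos x ^ 2 + k * Real.sin x ^ 2) ^ 2 +
      ((k - 1) * (Real.sin x * Real.cos x)) ^ 2 = Real.cos x ^ 2 + k ^ 2 * Real.sin x ^ 2 := by
    rw [show Real.sin x ^ 2 = 1 - Real.cos x ^ 2 by linarith, mul_pow, mul_pow,
      show Real.sin x ^ 2 = 1 - Real.cos x ^ 2 by linarith]
    ring
  simp only [Pi.mul_apply, Pi.add_apply, Pi.pow_apply, Pi.div_apply]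
  set c := Real.cos x
  set s := Real.sin x
  have e1 : 1 + ((k - 1) * (s * c) / (c ^ 2 + k * s ^ 2)) ^ 2 =
      (c ^ 2 + k ^ 2 * s ^ 2) / (c ^ 2 + k * s ^ 2) ^ 2 := by
    rw [← key]; field_simp
  have e2 : α * c ^ 2 + α * k ^ 2 * s ^ 2 = α * (c ^ 2 + k ^ 2 * s ^ 2) := by ring
  simp only [e1, e2]
  field_simp
  norm_num only [pow_one, Nat.cast_ofNat]
  linear_combination ((k - 1) * (c ^ 2 - k * s ^ 2) + k) * hsc

theorem strictMono_trigPrimitive {α β : ℝ} (hα : 0 < α) (hβ : 0 < β) :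
    StrictMono (trigPrimitive α β) :=
  strictMono_of_hasDerivAt_pos (hasDerivAt_trigPrimitive hα hβ)
    (fun x => one_div_pos.mpr (cos_sq_add_mul_sin_sq_pos hα hβ x))

section

variable {p T τ η : ℝ} {φ z : ℝ → ℝ} {I : Set ℝ} {x : EuclideanSpace ℝ (Fin 2)}

/-! ### The phase equations -/

/-- The coefficient `cos² + (p - 1) sin²` of the second derivative in the equation for the angular
profile, divided by the squared length of the gradient. -/
noncomputable def ellipticity (p x : ℝ) : ℝ := Real.cos x ^ 2 + (p - 1) * Real.sin x ^ 2

/-- The velocity of the phase `φ` of the angular profile, as a function of `x = φ` and of `z`,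
where `exp (-z)` is the length of the gradient on the unit circle. -/
noncomputable def phaseSpeed (p x z : ℝ) : ℝ :=
  (p * Real.cos x ^ 2 + 2 * (p - 1) * Real.sin x ^ 2 + p * Real.cos x * Real.exp z) /
    ellipticity p x

/-- The velocity of `z`, as a function of `x = φ` and of `z`, where `exp (-z)` is the length of the
gradient on the unit circle. -/
noncomputable def logSpeed (p x z : ℝ) : ℝ :=
  -(Real.sin x * ((p - 2) * Real.cos x + p * Real.exp z)) / ellipticity p x


theorem ellipticity_pos (hp : 1 < p) (x : ℝ) : 0 < ellipticity p x := by
  simpa [ellipticity] using cos_sq_add_mul_sin_sq_pos one_pos (sub_pos.mpr hp) x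

theorem min_le_ellipticity (x : ℝ) : min 1 (p - 1) ≤ ellipticity p x := by
  have h := Real.sin_sq_add_cos_sq x
  have h1 := min_le_left 1 (p - 1)
  have h2 := min_le_right 1 (p - 1)
  unfold ellipticity
  nlinarith [sq_nonneg (Real.cos x), sq_nonneg (Real.sin x)]

theorem ellipticity_le (hp : 1 < p) (x : ℝ) : ellipticity p x ≤ p := by
  have h := Real.sin_sq_add_cos_sq x
  unfold ellipticity
  nlinarith [sq_nonneg (Real.cos x), sq_nonneg (Real.sin x)]

theorem contDiff_phaseField (hp : 1 < p) (n : WithTop ℕ∞) :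
    ContDiff ℝ n (fun q : ℝ × ℝ => (phaseSpeed p q.1 q.2, logSpeed p q.1 q.2)) := by
  have h : ContDiff ℝ n (fun q : ℝ × ℝ => ellipticity p q.1) := by
    unfold ellipticity
    fun_prop
  unfold phaseSpeed logSpeed
  refine ContDiff.prodMk (ContDiff.div ?_ h fun q => (ellipticity_pos hp _).ne')
    (ContDiff.div ?_ h fun q => (ellipticity_pos hp _).ne') <;> fun_prop

theorem phaseSpeed_neg (x z : ℝ) : phaseSpeed p (-x) z = phaseSpeed p x z := by
  simp [phaseSpeed, ellipticity]

theorem logSpeed_neg (x z : ℝ) : logSpeed p (-x) z = -logSpeed p x z := by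
  simp [logSpeed, ellipticity, neg_div]

theorem phaseSpeed_zero (z : ℝ) : phaseSpeed p 0 z = p + p * Real.exp z := by
  simp [phaseSpeed, ellipticity]

theorem phaseSpeed_pi_div_two (hp : 1 < p) (z : ℝ) : phaseSpeed p (Real.pi / 2) z = 2 := by
  simp only [phaseSpeed, ellipticity, Real.cos_pi_div_two, Real.sin_pi_div_two]
  rw [div_eq_iff (by nlinarith)]
  ring

theorem logSpeed_le (hp : 1 < p) {x : ℝ} (hx : 0 ≤ Real.sin x) (z : ℝ) :
    logSpeed p x z ≤ |p - 2| / min 1 (p - 1) := by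
  have hm : 0 < min 1 (p - 1) := lt_min one_pos (by linarith)
  have hD := ellipticity_pos hp x
  have h1 : -(Real.sin x * ((p - 2) * Real.cos x + p * Real.exp z)) ≤ |p - 2| := by
    have h2 : -((p - 2) * (Real.sin x * Real.cos x)) ≤ |p - 2| * 1 := by
      refine (neg_le_abs _).trans ?_
      rw [abs_mul]
      refine mul_le_mul_of_nonneg_left ?_ (abs_nonneg _)
      rw [abs_mul]
      exact mul_le_one₀ (Real.abs_sin_le_one x) (abs_nonneg _) (Real.abs_cos_le_one x)
    have h3 : 0 ≤ Real.sin x * (p * Real.exp z) := by positivity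
    linarith
  calc logSpeed p x z ≤ |p - 2| / ellipticity p x := by unfold logSpeed; gcongr
    _ ≤ |p - 2| / min 1 (p - 1) := by gcongr; exact min_le_ellipticity x

theorem le_logSpeed (hp : 1 < p) (x : ℝ) {z M : ℝ} (hz : z ≤ M) :
    -((|p - 2| + p * Real.exp M) / min 1 (p - 1)) ≤ logSpeed p x z := by
  have hm : 0 < min 1 (p - 1) := lt_min one_pos (by linarith)
  have hD := ellipticity_pos hp x
  have h1 : Real.sin x * ((p - 2) * Real.cos x + p * Real.exp z) ≤ |p - 2| + p * Real.exp M := by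
    have h2 : (p - 2) * (Real.sin x * Real.cos x) ≤ |p - 2| * 1 := by
      refine (le_abs_self _).trans ?_
      rw [abs_mul]
      refine mul_le_mul_of_nonneg_left ?_ (abs_nonneg _)
      rw [abs_mul]
      exact mul_le_one₀ (Real.abs_sin_le_one x) (abs_nonneg _) (Real.abs_cos_le_one x)
    have h3 : Real.sin x * (p * Real.exp z) ≤ 1 * (p * Real.exp M) := by
      gcongr
      exact Real.sin_le_one x
    linarith
  unfold logSpeed
  rw [neg_div, neg_le_neg_iff]
  calc _ ≤ (|p - 2| + p * Real.exp M) / ellipticity p x := by gcongr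
    _ ≤ _ := by gcongr; exact min_le_ellipticity x

/-- Along the phase equations `cos φ · exp (-z)` has derivative `-2 sin φ · exp (-z)`. This
compatibility is what lets `φ` be the angle between the gradient of `r² f(θ)` and the radial
direction. -/
theorem hasDerivAt_cos_mul_exp (hp : 1 < p) {t : ℝ}
    (hφ : HasDerivAt φ (phaseSpeed p (φ t) (z t)) t)
    (hz : HasDerivAt z (logSpeed p (φ t) (z t)) t) :
    HasDerivAt (fun t => Real.cos (φ t) * Real.exp (-z t))
      (-(2 * (Real.sin (φ t) * Real.exp (-z t)))) t := by
  refine (hφ.cos.mul hz.neg.exp).congr_deriv ?_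
  have hD := (ellipticity_pos hp (φ t)).ne'
  unfold phaseSpeed logSpeed
  field_simp
  unfold ellipticity
  simp only [Pi.neg_apply]
  ring

/-- A solution of the phase equations on `(-T, T)` starting from the phase `0`. The phase is
truncated to `[-π, π]` in the equations, which makes the solutions global. The symmetry in time,
the sign of the phase and the growth bound follow from the equations. -/
structure IsPhaseCurve (p T : ℝ) (φ z : ℝ → ℝ) : Prop where
  phase_zero : φ 0 = 0
  hasDerivAt_phase : ∀ t ∈ Ioo (-T) T,
    HasDerivAt φ (phaseSpeed p (truncate (-Real.pi) Real.pi (φ t)) (z t)) t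
  hasDerivAt_log : ∀ t ∈ Ioo (-T) T,
    HasDerivAt z (logSpeed p (truncate (-Real.pi) Real.pi (φ t)) (z t)) t
  phase_neg : ∀ t ∈ Ioo (-T) T, φ (-t) = -φ t
  log_neg : ∀ t ∈ Ioo (-T) T, z (-t) = z t
  phase_nonneg : ∀ t ∈ Ico 0 T, 0 ≤ φ t
  log_le : ∀ t ∈ Ico 0 T, z t ≤ z 0 + |p - 2| / min 1 (p - 1) * t

theorem sin_truncate_nonneg {x : ℝ} (hx : 0 ≤ x) :
    0 ≤ Real.sin (truncate (-Real.pi) Real.pi x) := by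
  have hm := truncate_mem (neg_le_self Real.pi_pos.le) x
  refine Real.sin_nonneg_of_nonneg_of_le_pi ?_ hm.2
  exact le_max_of_le_right (le_min Real.pi_pos.le hx)

theorem truncate_pi_of_mem {x : ℝ} (h : -(Real.pi / 2) ≤ x) (h' : x ≤ Real.pi / 2) :
    truncate (-Real.pi) Real.pi x = x :=
  truncate_of_mem ⟨by linarith [Real.pi_pos], by linarith [Real.pi_pos]⟩

/-- A function whose derivative is positive wherever it takes the value `m` stays above `m`. -/
theorem le_of_deriv_pos_at_level {f f' : ℝ → ℝ} {a b m : ℝ}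
    (hf : ∀ t ∈ Icc a b, HasDerivWithinAt f (f' t) (Icc a b) t) (ha : m ≤ f a)
    (hm : ∀ t ∈ Ico a b, f t = m → 0 < f' t) : ∀ t ∈ Icc a b, m ≤ f t := by
  intro t ht
  have h := image_le_of_deriv_right_lt_deriv_boundary (f := fun t => -f t) (f' := fun t => -f' t)
    (a := a) (b := b) (B := fun _ => -m) (B' := fun _ => 0)
    (fun t ht => (hf t ht).continuousWithinAt.neg)
    (fun t ht => ((hf t (Ico_subset_Icc_self ht)).mono_of_mem_nhdsWithin
      (Icc_mem_nhdsGE_of_mem ht)).neg)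
    (neg_le_neg ha) (fun x => hasDerivAt_const x _)
    (fun t ht hft => neg_neg_of_pos (hm t ht (neg_injective hft))) ht
  exact neg_le_neg_iff.mp h

/-- All phase curves with initial value `z 0 = s`, `s ∈ [A, B]`, exist on `(-T, T)`, and the
phase at any given time depends continuously on `s`. -/
theorem exists_phaseCurve_family (hp : 1 < p) (hT : 0 < T) {A B : ℝ} (hAB : A ≤ B) :
    ∃ φ z : ℝ → ℝ → ℝ, (∀ s ∈ Icc A B, z s 0 = s ∧ IsPhaseCurve p T (φ s) (z s)) ∧
      ∀ t ∈ Ioo (-T) T, ContinuousOn (φ · t) (Icc A B) := by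
  have hm : 0 < min 1 (p - 1) := lt_min one_pos (by linarith)
  -- a priori, `z` stays in `[m, M]` on `[-T, T]`, so truncating it to this box changes nothing
  set C := |p - 2| / min 1 (p - 1)
  have hC0 : 0 ≤ C := by positivity
  set M := B + C * T
  set C' := (|p - 2| + p * Real.exp M) / min 1 (p - 1)
  have hC'0 : 0 ≤ C' := by positivity
  set m := A - C' * T
  have hmM : m ≤ M := by nlinarith [mul_nonneg hC0 hT.le, mul_nonneg hC'0 hT.le]
  have hπ : -Real.pi ≤ Real.pi := neg_le_self Real.pi_pos.le
  obtain ⟨K, L, hK, hL⟩ := exists_lipschitz_bounded_truncate (contDiff_phaseField hp 1) hπ hmM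
  set X : ℝ × ℝ → ℝ × ℝ := fun q => (phaseSpeed p (truncate (-Real.pi) Real.pi q.1)
    (truncate m M q.2), logSpeed p (truncate (-Real.pi) Real.pi q.1) (truncate m M q.2)) with hX
  obtain ⟨α, hα, hαc⟩ := exists_flow_of_lipschitz_of_bounded (X := X) hK hL (0, A) (B - A).toNNReal
    hT.le
  have hball : ∀ s ∈ Icc A B, ((0 : ℝ), s) ∈ Metric.closedBall ((0 : ℝ), A) (B - A).toNNReal := by
    intro s hs
    rw [Metric.mem_closedBall, Prod.dist_eq, Real.dist_eq, Real.dist_eq,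
      Real.coe_toNNReal _ (by linarith)]
    refine max_le (by simp; linarith) ?_
    rw [abs_of_nonneg (by linarith [hs.1])]
    linarith [hs.2]
  refine ⟨fun s t => (α (0, s) t).1, fun s t => (α (0, s) t).2, fun s hs => ?_, fun t ht => ?_⟩
  · obtain ⟨h0, hd⟩ := hα _ (hball s hs)
    set γ := α (0, s)
    have hcont : ContinuousOn γ (Icc (-T) T) := fun t ht => (hd t ht).continuousWithinAt
    -- the curve `t ↦ (-φ(-t), z(-t))` solves the same initial value problem
    have hsymm : ∀ t ∈ Icc 0 T, γ (-t) = (-(γ t).1, (γ t).2) := by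
      have hsub : Icc 0 T ⊆ Icc (-T) T := Icc_subset_Icc_left (by linarith)
      have hneg : MapsTo (fun t : ℝ => -t) (Icc (-T) T) (Icc (-T) T) :=
        fun t ht => ⟨by linarith [ht.2], by linarith [ht.1]⟩
      have hd' : ∀ t ∈ Icc (-T) T, HasDerivWithinAt (fun t => (-(γ (-t)).1, (γ (-t)).2))
          (X (-(γ (-t)).1, (γ (-t)).2)) (Icc (-T) T) t := by
        intro t ht
        have h1 := (hd (-t) (hneg ht)).scomp t (hasDerivAt_neg t).hasDerivWithinAt hneg
        have h2 := ((hasFDerivAt_fst (p := γ (-t))).comp_hasDerivWithinAt t h1).neg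
        have h3 := (hasFDerivAt_snd (p := γ (-t))).comp_hasDerivWithinAt t h1
        refine (h2.prodMk h3).congr_deriv ?_
        simp only [hX, truncate_neg Real.pi_pos.le, phaseSpeed_neg, logSpeed_neg]
        simp
      have hu := ODE_solution_unique (v := fun _ => X) (a := 0) (b := T) (fun _ => hK)
        (hcont.mono hsub)
        (fun t ht => (hd t (hsub (Ico_subset_Icc_self ht))).mono_of_mem_nhdsWithin
          (Icc_mem_nhdsGE_of_mem ⟨by linarith [ht.1], ht.2⟩))
        (fun t ht => (hd' t (hsub ht)).continuousWithinAt.mono hsub)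
        (fun t ht => (hd' t (hsub (Ico_subset_Icc_self ht))).mono_of_mem_nhdsWithin
          (Icc_mem_nhdsGE_of_mem ⟨by linarith [ht.1], ht.2⟩))
        (by simp [h0])
      intro t ht
      have := hu ht
      rw [this]
      simp
    have hsymm' : ∀ t ∈ Ioo (-T) T, γ (-t) = (-(γ t).1, (γ t).2) := by
      intro t ht
      rcases le_total 0 t with h | h
      · exact hsymm t ⟨h, ht.2.le⟩
      · have := hsymm (-t) ⟨by linarith, by linarith [ht.1]⟩
        rw [neg_neg] at this
        rw [this]
        simp
    have hd1 : ∀ t ∈ Icc (-T) T, HasDerivWithinAt (fun t => (γ t).1) (X (γ t)).1 (Icc (-T) T) t :=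
      fun t ht => (hasFDerivAt_fst (p := γ t)).comp_hasDerivWithinAt t (hd t ht)
    have hd2 : ∀ t ∈ Icc (-T) T, HasDerivWithinAt (fun t => (γ t).2) (X (γ t)).2 (Icc (-T) T) t :=
      fun t ht => (hasFDerivAt_snd (p := γ t)).comp_hasDerivWithinAt t (hd t ht)
    have hsub : Icc 0 T ⊆ Icc (-T) T := Icc_subset_Icc_left (by linarith)
    have hphase : ∀ t ∈ Icc 0 T, 0 ≤ (γ t).1 := by
      refine le_of_deriv_pos_at_level (fun t ht => (hd1 t (hsub ht)).mono hsub) (by simp [h0]) ?_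
      intro t _ h
      simp only [hX, h]
      rw [truncate_of_mem ⟨by linarith [Real.pi_pos], Real.pi_pos.le⟩, phaseSpeed_zero]
      positivity
    have hdi : ∀ t ∈ interior (Icc 0 T), HasDerivAt (fun t => (γ t).2) (X (γ t)).2 t := by
      intro t ht
      rw [interior_Icc] at ht
      exact (hd2 t (hsub (Ioo_subset_Icc_self ht))).hasDerivAt
        (Icc_mem_nhds (by linarith [ht.1]) ht.2)
    have hc2 : ContinuousOn (fun t => (γ t).2) (Icc 0 T) :=
      fun t ht => ((hd2 t (hsub ht)).continuousWithinAt).mono hsub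
    have hz0 : (γ 0).2 = s := by rw [h0]
    have hup : ∀ t ∈ Icc 0 T, (γ t).2 ≤ s + C * t := by
      intro t ht
      have := (convex_Icc 0 T).image_sub_le_mul_sub_of_deriv_le hc2
        (fun t ht => (hdi t ht).differentiableAt.differentiableWithinAt) (C := C)
        (fun t ht => by
          rw [(hdi t ht).deriv]
          exact logSpeed_le hp (sin_truncate_nonneg (hphase t (interior_subset ht))) _)
        0 ⟨le_rfl, hT.le⟩ t ht ht.1
      linarith
    have hbox : ∀ t ∈ Icc 0 T, (γ t).2 ∈ Icc m M := by
      intro t ht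
      have hI0 : (0 : ℝ) ∈ Icc 0 T := ⟨le_rfl, hT.le⟩
      constructor
      · have := (convex_Icc 0 T).mul_sub_le_image_sub_of_le_deriv hc2
          (fun t ht => (hdi t ht).differentiableAt.differentiableWithinAt) (C := -C')
          (fun t ht => by
            rw [(hdi t ht).deriv]
            exact le_logSpeed hp _ (truncate_mem hmM _).2) 0 hI0 t ht ht.1
        nlinarith [mul_le_mul_of_nonneg_left ht.2 hC'0, hs.1]
      · nlinarith [mul_le_mul_of_nonneg_left ht.2 hC0, hs.2, hup t ht]
    have htr : ∀ t ∈ Ioo (-T) T, truncate m M (γ t).2 = (γ t).2 := by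
      intro t ht
      refine truncate_of_mem ?_
      rcases le_total 0 t with h | h
      · exact hbox t ⟨h, ht.2.le⟩
      · have := hbox (-t) ⟨by linarith, by linarith [ht.1]⟩
        rwa [hsymm' t ht] at this
    refine ⟨hz0, congrArg Prod.fst h0, fun t ht => ?_, fun t ht => ?_,
      fun t ht => (congrArg Prod.fst (hsymm' t ht) :),
      fun t ht => (congrArg Prod.snd (hsymm' t ht) :),
      fun t ht => hphase t (Ico_subset_Icc_self ht), fun t ht => ?_⟩
    · have := (hd1 t (Ioo_subset_Icc_self ht)).hasDerivAt (Icc_mem_nhds ht.1 ht.2)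
      simpa only [hX, htr t ht] using this
    · have := (hd2 t (Ioo_subset_Icc_self ht)).hasDerivAt (Icc_mem_nhds ht.1 ht.2)
      simpa only [hX, htr t ht] using this
    · exact (hup t (Ico_subset_Icc_self ht)).trans_eq (congrArg (· + C * t) hz0.symm)
  · exact continuous_fst.comp_continuousOn ((hαc t (Ioo_subset_Icc_self ht)).comp
      (by fun_prop : ContinuousOn (fun s : ℝ => ((0 : ℝ), s)) (Icc A B)) hball)

/-! ### Shooting -/

namespace IsPhaseCurve

theorem continuousOn_phase (h : IsPhaseCurve p T φ z) : ContinuousOn φ (Ioo (-T) T) :=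
  fun t ht => (h.hasDerivAt_phase t ht).continuousAt.continuousWithinAt

theorem pi_div_two_le (h : IsPhaseCurve p T φ z) (hp : 1 < p) {t₁ t₂ : ℝ} (h0 : 0 ≤ t₁)
    (h12 : t₁ ≤ t₂) (h2 : t₂ < T) (h1 : Real.pi / 2 ≤ φ t₁) : Real.pi / 2 ≤ φ t₂ := by
  refine le_of_deriv_pos_at_level (a := t₁) (b := t₂)
    (fun t ht => (h.hasDerivAt_phase t
      ⟨by linarith [ht.1, ht.2], by linarith [ht.2]⟩).hasDerivWithinAt)
    h1 (fun t _ hφ => ?_) t₂ ⟨h12, le_rfl⟩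
  rw [hφ, truncate_pi_of_mem (by linarith [Real.pi_pos]) le_rfl, phaseSpeed_pi_div_two hp]
  exact two_pos

theorem lt_pi_div_two_of_lt (h : IsPhaseCurve p T φ z) (hp : 1 < p) (hτT : τ < T)
    (hτ : φ τ = Real.pi / 2) {t : ℝ} (ht : t ∈ Ico 0 τ) : φ t < Real.pi / 2 := by
  by_contra! hc
  have hd := h.hasDerivAt_phase τ ⟨by linarith [ht.1, ht.2], hτT⟩
  rw [hτ, truncate_pi_of_mem (by linarith [Real.pi_pos]) le_rfl, phaseSpeed_pi_div_two hp] at hd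
  -- the phase crosses `π/2` with velocity `2`, so it lies below `π/2` just before `τ`
  have hev := ((hasDerivAt_iff_tendsto_slope.mp hd).eventually (lt_mem_nhds two_pos)).filter_mono
    (nhdsLT_le_nhdsNE τ)
  obtain ⟨x, hx, hxt⟩ := (hev.and (Ioo_mem_nhdsLT ht.2)).exists
  have hge := h.pi_div_two_le hp ht.1 hxt.1.le (hxt.2.trans hτT) hc
  rw [slope_def_field, hτ] at hx
  exact absurd hx (not_lt.mpr (div_nonpos_of_nonneg_of_nonpos (by linarith) (by linarith [hxt.2])))

/-- For small initial values of `exp z` the phase cannot reach `π/2` before the critical angle: the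
equations are then close to those of the `p`-harmonic profile, obtained by dropping `exp z`. -/
theorem lt_pi_div_two (h : IsPhaseCurve p T φ z) (hp : 1 < p) (hτ0 : 0 < τ) (hτT : τ < T) {δ : ℝ}
    (hδ : ∀ t ∈ Icc 0 τ, Real.exp (z t) ≤ δ)
    (hτ : (1 + p * δ / min p (2 * (p - 1))) * τ <
      Real.pi / 2 - (p - 1) * (Real.pi / 2 / √(p * (2 * (p - 1))))) : φ τ < Real.pi / 2 := by
  by_contra! hc
  have hp0 : 0 < p := by linarith
  have hq0 : 0 < 2 * (p - 1) := by linarith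
  have hm : 0 < min p (2 * (p - 1)) := lt_min hp0 hq0
  have hδ0 : 0 ≤ δ := (Real.exp_pos _).le.trans (hδ 0 ⟨le_rfl, hτ0.le⟩)
  obtain ⟨t₁, ht₁, hφ₁⟩ : Real.pi / 2 ∈ φ '' Icc 0 τ :=
    intermediate_value_Icc hτ0.le
      (h.continuousOn_phase.mono fun t ht => ⟨by linarith [ht.1], by linarith [ht.2]⟩)
      ⟨by rw [h.phase_zero]; positivity, hc⟩
  -- along the curve `∫₀^φ D / P`, with `D = P - (p - 1)`, has a time derivative that exceeds `1`
  -- by at most a multiple of `exp z`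
  set P : ℝ → ℝ := fun x => p * Real.cos x ^ 2 + 2 * (p - 1) * Real.sin x ^ 2 with hP
  have hPpos : ∀ x, 0 < P x := cos_sq_add_mul_sin_sq_pos hp0 hq0
  have hPm : ∀ x, min p (2 * (p - 1)) ≤ P x := by
    intro x
    have := Real.sin_sq_add_cos_sq x
    nlinarith [min_le_left p (2 * (p - 1)), min_le_right p (2 * (p - 1)),
      sq_nonneg (Real.cos x), sq_nonneg (Real.sin x)]
  have hd : ∀ t ∈ Icc 0 t₁, HasDerivAt
      (fun t => φ t - (p - 1) * trigPrimitive p (2 * (p - 1)) (φ t))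
      (1 + p * Real.cos (φ t) * Real.exp (z t) / P (φ t)) t := by
    intro t ht
    have hIoo : t ∈ Ioo (-T) T := ⟨by linarith [ht.1], by linarith [ht.2, ht₁.2]⟩
    have hle : φ t ≤ Real.pi / 2 := by
      rcases ht.2.eq_or_lt with he | hl
      · rw [he, hφ₁]
      · exact (h.lt_pi_div_two_of_lt hp (ht₁.2.trans_lt hτT) hφ₁ ⟨ht.1, hl⟩).le
    have h1 := h.hasDerivAt_phase t hIoo
    rw [truncate_pi_of_mem (by linarith [Real.pi_pos, h.phase_nonneg t ⟨ht.1, hIoo.2⟩]) hle] at h1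
    refine (h1.sub (((hasDerivAt_trigPrimitive hp0 hq0 (φ t)).comp t h1).const_mul
      (p - 1))).congr_deriv ?_
    have hDP : ellipticity p (φ t) = P (φ t) - (p - 1) := by
      simp only [hP, ellipticity]
      linear_combination -(p - 1) * Real.sin_sq_add_cos_sq (φ t)
    have hD := (ellipticity_pos hp (φ t)).ne'
    have hP0 := (hPpos (φ t)).ne'
    change phaseSpeed p (φ t) (z t) - (p - 1) * (1 / P (φ t) * phaseSpeed p (φ t) (z t)) = _
    have hs : phaseSpeed p (φ t) (z t) =
        (P (φ t) + p * Real.cos (φ t) * Real.exp (z t)) / ellipticity p (φ t) := rfl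
    rw [hs]
    field_simp
    rw [hDP]
  have hle := (convex_Icc 0 t₁).image_sub_le_mul_sub_of_deriv_le
    (fun t ht => (hd t ht).continuousAt.continuousWithinAt)
    (fun t ht => (hd t (interior_subset ht)).differentiableAt.differentiableWithinAt)
    (C := 1 + p * δ / min p (2 * (p - 1)))
    (fun t ht => by
      have ht := interior_subset ht
      rw [(hd t ht).deriv]
      have hb := hδ t ⟨ht.1, ht.2.trans ht₁.2⟩
      have hcb : p * Real.cos (φ t) * Real.exp (z t) ≤ p * δ := by
        calc p * Real.cos (φ t) * Real.exp (z t) ≤ p * 1 * δ := by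
              gcongr
              exact Real.cos_le_one _
          _ = p * δ := by ring
      have : p * Real.cos (φ t) * Real.exp (z t) / P (φ t) ≤ p * δ / min p (2 * (p - 1)) :=
        div_le_div₀ (by positivity) hcb hm (hPm _)
      linarith)
    0 ⟨le_rfl, ht₁.1⟩ t₁ ⟨ht₁.1, le_rfl⟩ ht₁.1
  simp only [hφ₁, h.phase_zero, trigPrimitive_zero, trigPrimitive_pi_div_two] at hle
  have : (1 + p * δ / min p (2 * (p - 1))) * t₁ ≤ (1 + p * δ / min p (2 * (p - 1))) * τ :=
    mul_le_mul_of_nonneg_left ht₁.2 (by positivity)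
  linarith

/-- For large initial values of `exp z` the phase reaches `π/2` early: `cos φ · exp (-z)` decreases,
so that `φ' ≥ 1 + exp (z 0) cos² φ`. -/
theorem pi_div_two_le_of_large (h : IsPhaseCurve p T φ z) (hp : 1 < p) (hτ0 : 0 < τ) (hτT : τ < T)
    (hτ : Real.pi / 2 / √(1 + Real.exp (z 0)) ≤ τ) : Real.pi / 2 ≤ φ τ := by
  by_contra! hc
  have hlt : ∀ t ∈ Icc 0 τ, φ t < Real.pi / 2 := fun t ht => by
    by_contra! hcc
    exact absurd (h.pi_div_two_le hp ht.1 ht.2 hτT hcc) (not_le.mpr hc)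
  have hIoo : ∀ t ∈ Icc 0 τ, t ∈ Ioo (-T) T :=
    fun t ht => ⟨by linarith [ht.1], by linarith [ht.2]⟩
  have hnn : ∀ t ∈ Icc 0 τ, 0 ≤ φ t := fun t ht => h.phase_nonneg t ⟨ht.1, (hIoo t ht).2⟩
  have hcos : ∀ t ∈ Icc 0 τ, 0 ≤ Real.cos (φ t) := fun t ht =>
    Real.cos_nonneg_of_mem_Icc ⟨by linarith [hnn t ht, Real.pi_pos], (hlt t ht).le⟩
  have hdy : ∀ t ∈ Icc 0 τ, HasDerivAt (fun t => Real.cos (φ t) * Real.exp (-z t))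
      (-(2 * (Real.sin (φ t) * Real.exp (-z t)))) t := fun t ht => by
    have htr := truncate_pi_of_mem (by linarith [hnn t ht, Real.pi_pos]) (hlt t ht).le
    exact hasDerivAt_cos_mul_exp hp (htr ▸ h.hasDerivAt_phase t (hIoo t ht))
      (htr ▸ h.hasDerivAt_log t (hIoo t ht))
  have hanti : AntitoneOn (fun t => Real.cos (φ t) * Real.exp (-z t)) (Icc 0 τ) := by
    refine antitoneOn_of_deriv_nonpos (convex_Icc 0 τ)
      (fun t ht => (hdy t ht).continuousAt.continuousWithinAt)
      (fun t ht => (hdy t (interior_subset ht)).differentiableAt.differentiableWithinAt) ?_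
    intro t ht
    have ht := interior_subset ht
    rw [(hdy t ht).deriv]
    have := Real.sin_nonneg_of_nonneg_of_le_pi (hnn t ht) (by linarith [hlt t ht, Real.pi_pos])
    have : 0 ≤ Real.sin (φ t) * Real.exp (-z t) := by positivity
    linarith
  set H := trigPrimitive (1 + Real.exp (z 0)) 1
  have hα : 0 < 1 + Real.exp (z 0) := by positivity
  have hd : ∀ t ∈ Icc 0 τ, HasDerivAt (fun t => H (φ t))
      (1 / ((1 + Real.exp (z 0)) * Real.cos (φ t) ^ 2 + 1 * Real.sin (φ t) ^ 2) *
        phaseSpeed p (φ t) (z t)) t := by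
    intro t ht
    have h1 := h.hasDerivAt_phase t (hIoo t ht)
    rw [truncate_pi_of_mem (by linarith [Real.pi_pos, hnn t ht]) (hlt t ht).le] at h1
    exact (hasDerivAt_trigPrimitive hα one_pos (φ t)).comp t h1
  have hle := (convex_Icc 0 τ).mul_sub_le_image_sub_of_le_deriv
    (fun t ht => (hd t ht).continuousAt.continuousWithinAt)
    (fun t ht => (hd t (interior_subset ht)).differentiableAt.differentiableWithinAt)
    (C := 1)
    (fun t ht => by
      have ht := interior_subset ht
      rw [(hd t ht).deriv, one_div, inv_mul_eq_div,
        one_le_div (cos_sq_add_mul_sin_sq_pos hα one_pos _), phaseSpeed,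
        le_div_iff₀ (ellipticity_pos hp _)]
      have hsc := Real.sin_sq_add_cos_sq (φ t)
      have hc0 := hcos t ht
      have h1 : Real.cos (φ t) * Real.exp (z 0) ≤ Real.exp (z t) := by
        have h2 := hanti ⟨le_rfl, hτ0.le⟩ ht ht.1
        simp only [h.phase_zero, Real.cos_zero, one_mul, Real.exp_neg] at h2
        rw [← div_eq_mul_inv, div_le_iff₀ (Real.exp_pos _), inv_mul_eq_div,
          le_div_iff₀ (Real.exp_pos _)] at h2
        exact h2
      have h3 : p * Real.cos (φ t) * (Real.cos (φ t) * Real.exp (z 0)) ≤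
          p * Real.cos (φ t) * Real.exp (z t) := by gcongr
      have h4 : Real.exp (z 0) * Real.cos (φ t) ^ 2 * ellipticity p (φ t) ≤
          Real.exp (z 0) * Real.cos (φ t) ^ 2 * p := by
        gcongr
        exact ellipticity_le hp _
      have h5 : ellipticity p (φ t) ≤
          p * Real.cos (φ t) ^ 2 + 2 * (p - 1) * Real.sin (φ t) ^ 2 := by
        unfold ellipticity
        nlinarith [sq_nonneg (Real.cos (φ t)), sq_nonneg (Real.sin (φ t))]
      have h6 : ((1 + Real.exp (z 0)) * Real.cos (φ t) ^ 2 + 1 * Real.sin (φ t) ^ 2) =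
          1 + Real.exp (z 0) * Real.cos (φ t) ^ 2 := by linear_combination hsc
      rw [h6]
      linarith)
    0 ⟨le_rfl, hτ0.le⟩ τ ⟨hτ0.le, le_rfl⟩ hτ0.le
  have hH := strictMono_trigPrimitive hα one_pos hc
  simp only [h.phase_zero, H, trigPrimitive_zero] at hle
  rw [trigPrimitive_pi_div_two, mul_one] at hH
  linarith

end IsPhaseCurve

/-- Below the critical half-angle some phase curve reaches `π/2` exactly at time `τ`. -/
theorem exists_phaseCurve_eq_pi_div_two (hp : 1 < p) (hτ0 : 0 < τ) (hτT : τ < T)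
    (hτ : τ < Real.pi / 2 - (p - 1) * (Real.pi / 2 / √(p * (2 * (p - 1))))) :
    ∃ φ z : ℝ → ℝ, IsPhaseCurve p T φ z ∧ φ τ = Real.pi / 2 := by
  have hp0 : 0 < p := by linarith
  have hm : 0 < min p (2 * (p - 1)) := lt_min hp0 (by linarith)
  have hm1 : 0 < min 1 (p - 1) := lt_min one_pos (by linarith)
  set G := Real.pi / 2 - (p - 1) * (Real.pi / 2 / √(p * (2 * (p - 1))))
  obtain ⟨δ, hδ0, hδ⟩ : ∃ δ > 0, (1 + p * δ / min p (2 * (p - 1))) * τ < G := by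
    refine ⟨(G - τ) / 2 * min p (2 * (p - 1)) / (p * τ), ?_, ?_⟩
    · have : 0 < G - τ := by linarith
      positivity
    · field_simp
      linarith
  set C := |p - 2| / min 1 (p - 1)
  have hC0 : 0 ≤ C := by positivity
  -- `A` keeps `exp z ≤ δ` up to time `τ`; `B` makes `√(1 + exp B) ≥ π / (2 τ)`
  set A := Real.log δ - C * τ
  set B := max A (Real.log ((Real.pi / 2 / τ) ^ 2))
  have hAB : A ≤ B := le_max_left _ _
  obtain ⟨φ, z, hφ, hcont⟩ := exists_phaseCurve_family hp (hτ0.trans hτT) hAB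
  have hA : φ A τ ≤ Real.pi / 2 := by
    obtain ⟨hz, hcurve⟩ := hφ A ⟨le_rfl, hAB⟩
    refine (hcurve.lt_pi_div_two hp hτ0 hτT (fun t ht => ?_) hδ).le
    rw [← Real.le_log_iff_exp_le hδ0]
    have := hcurve.log_le t ⟨ht.1, by linarith [ht.2]⟩
    rw [hz] at this
    have h2 : C * t ≤ C * τ := mul_le_mul_of_nonneg_left ht.2 hC0
    linarith
  have hB : Real.pi / 2 ≤ φ B τ := by
    obtain ⟨hz, hcurve⟩ := hφ B ⟨hAB, le_rfl⟩
    refine hcurve.pi_div_two_le_of_large hp hτ0 hτT ?_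
    have hq : 0 < Real.pi / 2 / τ := by positivity
    have h1 : (Real.pi / 2 / τ) ^ 2 ≤ 1 + Real.exp B := by
      have := (Real.log_le_iff_le_exp (pow_pos hq 2)).mp
        (le_max_right A (Real.log ((Real.pi / 2 / τ) ^ 2)))
      linarith
    have h2 : Real.pi / 2 / τ ≤ √(1 + Real.exp B) := Real.le_sqrt_of_sq_le h1
    rw [hz, div_le_iff₀ (by positivity)]
    rwa [div_le_iff₀ hτ0, mul_comm] at h2
  obtain ⟨s, hs, hsτ⟩ := intermediate_value_Icc hAB (hcont τ ⟨by linarith, hτT⟩) ⟨hA, hB⟩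
  exact ⟨φ s, z s, (hφ s hs).2, hsτ⟩

/-! ### The two-homogeneous function with a given angular profile -/

/-- `φ` and `z` solve the phase equations, without truncation, at the times in `I`. -/
structure IsPhaseSolution (p : ℝ) (I : Set ℝ) (φ z : ℝ → ℝ) : Prop where
  hasDerivAt_phase : ∀ t ∈ I, HasDerivAt φ (phaseSpeed p (φ t) (z t)) t
  hasDerivAt_log : ∀ t ∈ I, HasDerivAt z (logSpeed p (φ t) (z t)) t

/-- The angular profile `f = cos φ · exp (-z) / 2`, whose derivative is `-sin φ · exp (-z)`. -/
noncomputable def angularProfile (φ z : ℝ → ℝ) (t : ℝ) : ℝ :=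
  1 / 2 * (Real.cos (φ t) * Real.exp (-z t))

/-- The polar angle of a point of the open right half-plane; its value at the origin is `0`. -/
noncomputable def polarAngle (x : EuclideanSpace ℝ (Fin 2)) : ℝ := Real.arctan (x 1 / x 0)

/-- The function `r² f(θ)` in polar coordinates of the right half-plane. -/
noncomputable def twoHomogeneous (f : ℝ → ℝ) (x : EuclideanSpace ℝ (Fin 2)) : ℝ :=
  (x 0 ^ 2 + x 1 ^ 2) * f (polarAngle x)

/-- The points of the open right half-plane whose polar angle lies in `I`. -/
def sector (I : Set ℝ) : Set (EuclideanSpace ℝ (Fin 2)) := {x | 0 < x 0 ∧ polarAngle x ∈ I}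


theorem contDiffAt_polarAngle (hx : 0 < x 0) (n : WithTop ℕ∞) : ContDiffAt ℝ n polarAngle x := by
  unfold polarAngle
  refine Real.contDiff_arctan.contDiffAt.comp x (ContDiffAt.div ?_ ?_ hx.ne') <;> fun_prop

theorem isOpen_sector (hI : IsOpen I) : IsOpen (sector I) := by
  rw [isOpen_iff_mem_nhds]
  intro x hx
  have h0 : ∀ᶠ y : EuclideanSpace ℝ (Fin 2) in 𝓝 x, 0 < y 0 :=
    (by fun_prop : Continuous fun y : EuclideanSpace ℝ (Fin 2) => y 0).continuousAt.eventually_mem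
      (Ioi_mem_nhds hx.1)
  filter_upwards [h0, (contDiffAt_polarAngle hx.1 0).continuousAt.eventually_mem
    (hI.mem_nhds hx.2)] with y h1 h2
  exact ⟨h1, h2⟩

theorem normSq_pos (hx : 0 < x 0) : 0 < x 0 ^ 2 + x 1 ^ 2 := by positivity

theorem hasFDerivAt_coord (i : Fin 2) (x : EuclideanSpace ℝ (Fin 2)) :
    HasFDerivAt (fun y : EuclideanSpace ℝ (Fin 2) => y i)
      (EuclideanSpace.proj i : EuclideanSpace ℝ (Fin 2) →L[ℝ] ℝ) x :=
  (EuclideanSpace.proj i : EuclideanSpace ℝ (Fin 2) →L[ℝ] ℝ).hasFDerivAt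

/-- The linear form with coefficients `a` and `b` on the plane. -/
noncomputable def planeForm (a b : ℝ) : EuclideanSpace ℝ (Fin 2) →L[ℝ] ℝ :=
  a • (EuclideanSpace.proj 0 : EuclideanSpace ℝ (Fin 2) →L[ℝ] ℝ) +
    b • (EuclideanSpace.proj 1 : EuclideanSpace ℝ (Fin 2) →L[ℝ] ℝ)

theorem planeForm_apply (a b : ℝ) (v : EuclideanSpace ℝ (Fin 2)) :
    planeForm a b v = a * v 0 + b * v 1 := by
  simp [planeForm]

theorem toDual_vec (a b : ℝ) :
    InnerProductSpace.toDual ℝ (EuclideanSpace ℝ (Fin 2)) !₂[a, b] = planeForm a b := by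
  ext v
  simp [planeForm_apply, PiLp.inner_apply, Fin.sum_univ_two, mul_comm]

theorem hasFDerivAt_polarAngle (hx : 0 < x 0) :
    HasFDerivAt polarAngle
      (planeForm (-x 1 / (x 0 ^ 2 + x 1 ^ 2)) (x 0 / (x 0 ^ 2 + x 1 ^ 2))) x := by
  have hN := (normSq_pos hx).ne'
  have hq := (hasFDerivAt_coord 1 x).mul ((hasDerivAt_inv hx.ne').comp_hasFDerivAt x
    (hasFDerivAt_coord 0 x))
  have h := (Real.hasDerivAt_arctan (x 1 * (x 0)⁻¹)).comp_hasFDerivAt x hq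
  refine HasFDerivAt.congr_fderiv (h.congr_of_eventuallyEq (.of_forall fun y => ?_)) ?_
  · simp [polarAngle, div_eq_mul_inv]
  · ext v
    have : 1 + (x 1 * (x 0)⁻¹) ^ 2 = (x 0 ^ 2 + x 1 ^ 2) / x 0 ^ 2 := by field_simp
    simp [planeForm_apply, this]
    field_simp

theorem hasFDerivAt_normSq (x : EuclideanSpace ℝ (Fin 2)) :
    HasFDerivAt (fun y : EuclideanSpace ℝ (Fin 2) => y 0 ^ 2 + y 1 ^ 2)
      (planeForm (2 * x 0) (2 * x 1)) x := by
  refine (((hasFDerivAt_coord 0 x).pow 2).add ((hasFDerivAt_coord 1 x).pow 2)).congr_fderiv ?_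
  ext v
  simp [planeForm_apply]

theorem IsPhaseSolution.hasDerivAt_angularProfile (h : IsPhaseSolution p I φ z) (hp : 1 < p) {t : ℝ}
    (ht : t ∈ I) :
    HasDerivAt (angularProfile φ z) (-(Real.sin (φ t) * Real.exp (-z t))) t := by
  refine ((hasDerivAt_cos_mul_exp hp (h.hasDerivAt_phase t ht)
    (h.hasDerivAt_log t ht)).const_mul (1 / 2)).congr_deriv ?_
  ring

/-- The gradient of `r² f(θ)` in Cartesian coordinates: it has length `r exp (-z)`, and `φ` is
the angle from it to the radial direction. -/
theorem IsPhaseSolution.hasGradientAt (h : IsPhaseSolution p I φ z) (hp : 1 < p)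
    (hx : x ∈ sector I) :
    HasGradientAt (twoHomogeneous (angularProfile φ z))
      !₂[Real.exp (-z (polarAngle x)) *
          (Real.cos (φ (polarAngle x)) * x 0 + Real.sin (φ (polarAngle x)) * x 1),
        Real.exp (-z (polarAngle x)) *
          (Real.cos (φ (polarAngle x)) * x 1 - Real.sin (φ (polarAngle x)) * x 0)] x := by
  rw [hasGradientAt_iff_hasFDerivAt, toDual_vec]
  refine ((hasFDerivAt_normSq x).mul ((h.hasDerivAt_angularProfile hp hx.2).comp_hasFDerivAt x
    (hasFDerivAt_polarAngle hx.1))).congr_fderiv ?_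
  have hN := (normSq_pos hx.1).ne'
  ext v
  simp [planeForm_apply, angularProfile]
  field_simp
  ring

theorem norm_vec (a b : ℝ) : ‖(!₂[a, b] : EuclideanSpace ℝ (Fin 2))‖ = √(a ^ 2 + b ^ 2) := by
  simp [EuclideanSpace.norm_eq, Fin.sum_univ_two]

theorem IsPhaseSolution.norm_gradient (h : IsPhaseSolution p I φ z) (hp : 1 < p)
    (hx : x ∈ sector I) :
    ‖gradient (twoHomogeneous (angularProfile φ z)) x‖ =
      Real.exp (1 / 2 * Real.log (x 0 ^ 2 + x 1 ^ 2) - z (polarAngle x)) := by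
  have hN := normSq_pos hx.1
  rw [(h.hasGradientAt hp hx).gradient, norm_vec, Real.sqrt_eq_iff_mul_self_eq (by positivity)
    (Real.exp_pos _).le, ← Real.exp_add,
    show 1 / 2 * Real.log (x 0 ^ 2 + x 1 ^ 2) - z (polarAngle x) +
      (1 / 2 * Real.log (x 0 ^ 2 + x 1 ^ 2) - z (polarAngle x)) =
      Real.log (x 0 ^ 2 + x 1 ^ 2) + (-z (polarAngle x) + -z (polarAngle x)) by ring,
    Real.exp_add, Real.exp_log hN, Real.exp_add]
  linear_combination (x 0 ^ 2 + x 1 ^ 2) * Real.exp (-z (polarAngle x)) ^ 2 *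
    Real.sin_sq_add_cos_sq (φ (polarAngle x))

theorem IsPhaseSolution.gradient_ne_zero (h : IsPhaseSolution p I φ z) (hp : 1 < p)
    (hx : x ∈ sector I) : gradient (twoHomogeneous (angularProfile φ z)) x ≠ 0 := by
  rw [← norm_pos_iff, h.norm_gradient hp hx]
  exact Real.exp_pos _

/-- The combination of the velocities of `φ` and `z` that appears in `div (|∇u|^(p-2) ∇u)`. -/
theorem phase_identity (hp : 1 < p) (x z : ℝ) :
    p * Real.cos x + (p - 1) * logSpeed p x z * Real.sin x - phaseSpeed p x z * Real.cos x =
      -(p * Real.exp z) := by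
  have hD := (ellipticity_pos hp x).ne'
  unfold phaseSpeed logSpeed
  field_simp
  unfold ellipticity
  ring

/-- The value of `div (|∇u|^(p-2) ∇u)`, where `|∇u|^(p-2) exp (-z)` is written as an
exponential. -/
theorem IsPhaseSolution.fderiv_flux (h : IsPhaseSolution p I φ z) (hp : 1 < p)
    (hx : x ∈ sector I) :
    fderiv ℝ (fun y : EuclideanSpace ℝ (Fin 2) =>
        Real.exp ((p - 2) / 2 * Real.log (y 0 ^ 2 + y 1 ^ 2) - (p - 1) * z (polarAngle y)) *
          (Real.cos (φ (polarAngle y)) * y 0 + Real.sin (φ (polarAngle y)) * y 1)) x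
        (EuclideanSpace.single 0 1) +
      fderiv ℝ (fun y : EuclideanSpace ℝ (Fin 2) =>
        Real.exp ((p - 2) / 2 * Real.log (y 0 ^ 2 + y 1 ^ 2) - (p - 1) * z (polarAngle y)) *
          (Real.cos (φ (polarAngle y)) * y 1 - Real.sin (φ (polarAngle y)) * y 0)) x
        (EuclideanSpace.single 1 1) =
      -(p * Real.exp (z (polarAngle x))) *
        Real.exp ((p - 2) / 2 * Real.log (x 0 ^ 2 + x 1 ^ 2) - (p - 1) * z (polarAngle x)) := by
  have hN := normSq_pos hx.1
  have hθ := hasFDerivAt_polarAngle hx.1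
  have hφ := (h.hasDerivAt_phase _ hx.2).comp_hasFDerivAt x hθ
  have hw := ((((hasFDerivAt_normSq x).log hN.ne').const_mul ((p - 2) / 2)).sub
    (((h.hasDerivAt_log _ hx.2).comp_hasFDerivAt x hθ).const_mul (p - 1))).exp
  have h0 := hw.mul ((hφ.cos.mul (hasFDerivAt_coord 0 x)).add
    (hφ.sin.mul (hasFDerivAt_coord 1 x)))
  have h1 := hw.mul ((hφ.cos.mul (hasFDerivAt_coord 1 x)).sub
    (hφ.sin.mul (hasFDerivAt_coord 0 x)))
  rw [HasFDerivAt.fderiv (f := fun y : EuclideanSpace ℝ (Fin 2) =>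
      Real.exp ((p - 2) / 2 * Real.log (y 0 ^ 2 + y 1 ^ 2) - (p - 1) * z (polarAngle y)) *
        (Real.cos (φ (polarAngle y)) * y 0 + Real.sin (φ (polarAngle y)) * y 1)) h0,
    HasFDerivAt.fderiv (f := fun y : EuclideanSpace ℝ (Fin 2) =>
      Real.exp ((p - 2) / 2 * Real.log (y 0 ^ 2 + y 1 ^ 2) - (p - 1) * z (polarAngle y)) *
        (Real.cos (φ (polarAngle y)) * y 1 - Real.sin (φ (polarAngle y)) * y 0)) h1]
  have key := phase_identity hp (φ (polarAngle x)) (z (polarAngle x))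
  simp [planeForm_apply]
  set W := Real.exp ((p - 2) / 2 * Real.log (x 0 ^ 2 + x 1 ^ 2) - (p - 1) * z (polarAngle x))
  field_simp
  linear_combination W * (x 0 ^ 2 + x 1 ^ 2) * key

/-- The two-homogeneous function built from a solution of the phase equations solves the game
`p`-Laplace equation with right-hand side `-1`. -/
theorem IsPhaseSolution.gamePLaplacian_eq (h : IsPhaseSolution p I φ z) (hp : 1 < p)
    (hI : IsOpen I) (hx : x ∈ sector I) :
    gamePLaplacian p (twoHomogeneous (angularProfile φ z)) x = -1 := by
  set u := twoHomogeneous (angularProfile φ z) with hu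
  have hnorm : ∀ y ∈ sector I, ‖gradient u y‖ ^ (p - 2) * Real.exp (-z (polarAngle y)) =
      Real.exp ((p - 2) / 2 * Real.log (y 0 ^ 2 + y 1 ^ 2) - (p - 1) * z (polarAngle y)) := by
    intro y hy
    rw [h.norm_gradient hp hy, ← Real.exp_mul, ← Real.exp_add]
    ring_nf
  have hev : ∀ᶠ y in 𝓝 x, y ∈ sector I := (isOpen_sector hI).mem_nhds hx
  have h0 : (fun y => (‖gradient u y‖ ^ (p - 2) • gradient u y) 0) =ᶠ[𝓝 x]
      fun y => Real.exp ((p - 2) / 2 * Real.log (y 0 ^ 2 + y 1 ^ 2) - (p - 1) * z (polarAngle y)) *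
        (Real.cos (φ (polarAngle y)) * y 0 + Real.sin (φ (polarAngle y)) * y 1) := by
    filter_upwards [hev] with y hy
    rw [← hnorm y hy, PiLp.smul_apply, smul_eq_mul, mul_assoc]
    congr 1
    rw [hu, (h.hasGradientAt hp hy).gradient]
    simp
  have h1 : (fun y => (‖gradient u y‖ ^ (p - 2) • gradient u y) 1) =ᶠ[𝓝 x]
      fun y => Real.exp ((p - 2) / 2 * Real.log (y 0 ^ 2 + y 1 ^ 2) - (p - 1) * z (polarAngle y)) *
        (Real.cos (φ (polarAngle y)) * y 1 - Real.sin (φ (polarAngle y)) * y 0) := by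
    filter_upwards [hev] with y hy
    rw [← hnorm y hy, PiLp.smul_apply, smul_eq_mul, mul_assoc]
    congr 1
    rw [hu, (h.hasGradientAt hp hy).gradient]
    simp
  rw [gamePLaplacian, divergence, Fin.sum_univ_two, h0.fderiv_eq, h1.fderiv_eq,
    h.fderiv_flux hp hx, h.norm_gradient hp hx, ← Real.exp_mul]
  have hp0 : p ≠ 0 := by linarith
  have hprod : Real.exp ((1 / 2 * Real.log (x 0 ^ 2 + x 1 ^ 2) - z (polarAngle x)) * (2 - p)) *
      (Real.exp (z (polarAngle x)) * Real.exp ((p - 2) / 2 * Real.log (x 0 ^ 2 + x 1 ^ 2) -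
        (p - 1) * z (polarAngle x))) = 1 := by
    rw [← Real.exp_add, ← Real.exp_add, Real.exp_eq_one_iff]
    ring
  calc _ = -(p / p) * (Real.exp ((1 / 2 * Real.log (x 0 ^ 2 + x 1 ^ 2) - z (polarAngle x)) *
      (2 - p)) * (Real.exp (z (polarAngle x)) * Real.exp ((p - 2) / 2 *
        Real.log (x 0 ^ 2 + x 1 ^ 2) - (p - 1) * z (polarAngle x)))) := by ring
    _ = -1 := by rw [hprod, div_self hp0, mul_one]

theorem IsPhaseSolution.contDiffOn_angularProfile {a b : ℝ}
    (h : IsPhaseSolution p (Icc a b) φ z) (hp : 1 < p) (n : ℕ∞) :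
    ContDiffOn ℝ n (angularProfile φ z) (Icc a b) := by
  have hγ : ContDiffOn ℝ n (fun t => (φ t, z t)) (Icc a b) :=
    ODE.contDiffOn_enat_Icc_of_hasDerivWithinAt
      (f := fun _ q => (phaseSpeed p q.1 q.2, logSpeed p q.1 q.2)) (u := univ)
      ((contDiff_phaseField hp n).comp contDiff_snd).contDiffOn
      (fun t ht => ((h.hasDerivAt_phase t ht).prodMk (h.hasDerivAt_log t ht)).hasDerivWithinAt)
      (mapsTo_univ _ _)
  have hφ : ContDiffOn ℝ n φ (Icc a b) := contDiff_fst.comp_contDiffOn hγ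
  have hz : ContDiffOn ℝ n z (Icc a b) := contDiff_snd.comp_contDiffOn hγ
  unfold angularProfile
  exact contDiffOn_const.mul (hφ.cos.mul hz.neg.exp)

theorem IsPhaseSolution.contDiffOn_twoHomogeneous {a b : ℝ}
    (h : IsPhaseSolution p (Icc a b) φ z) (hp : 1 < p) (n : ℕ∞) :
    ContDiffOn ℝ n (twoHomogeneous (angularProfile φ z)) (sector (Ioo a b)) := by
  intro x hx
  refine ContDiffAt.contDiffWithinAt ?_
  have hf := (h.contDiffOn_angularProfile hp n).contDiffAt (Icc_mem_nhds hx.2.1 hx.2.2)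
  unfold twoHomogeneous
  exact ContDiffAt.mul (by fun_prop) (hf.comp x (contDiffAt_polarAngle hx.1 n))

/-! ### Phase solutions past the boundary angle -/

theorem IsPhaseSolution.mono {I J : Set ℝ} (h : IsPhaseSolution p I φ z) (hJ : J ⊆ I) :
    IsPhaseSolution p J φ z :=
  ⟨fun t ht => h.hasDerivAt_phase t (hJ ht), fun t ht => h.hasDerivAt_log t (hJ ht)⟩

/-- The phase curve that reaches `π/2` at time `τ` solves the equations without truncation slightly
beyond `[-τ, τ]`, because its phase stays below `π` there. -/
theorem exists_phaseSolution (hp : 1 < p) (hτ0 : 0 < τ)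
    (hτ : τ < Real.pi / 2 - (p - 1) * (Real.pi / 2 / √(p * (2 * (p - 1))))) :
    ∃ σ > τ, ∃ φ z : ℝ → ℝ, IsPhaseSolution p (Icc (-σ) σ) φ z ∧ φ τ = Real.pi / 2 ∧
      φ (-τ) = -(Real.pi / 2) ∧ ∀ t ∈ Ioo (-τ) τ, φ t ∈ Ioo (-(Real.pi / 2)) (Real.pi / 2) := by
  obtain ⟨φ, z, h, hφ⟩ := exists_phaseCurve_eq_pi_div_two hp hτ0 (lt_add_one τ) hτ
  have hlt : ∀ t ∈ Ico 0 τ, φ t < Real.pi / 2 :=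
    fun t ht => h.lt_pi_div_two_of_lt hp (lt_add_one τ) hφ ht
  have hτT : τ ∈ Ioo (-(τ + 1)) (τ + 1) := ⟨by linarith, by linarith⟩
  have hev : ∀ᶠ t in 𝓝 τ, φ t < Real.pi :=
    (h.hasDerivAt_phase τ hτT).continuousAt.eventually_lt continuousAt_const
      (by rw [hφ]; linarith [Real.pi_pos])
  obtain ⟨ε, hε, hball⟩ := Metric.eventually_nhds_iff.mp hev
  set σ := τ + min ε 1 / 2 with hσ
  have hmin : 0 < min ε 1 := lt_min hε one_pos
  have hστ : τ < σ := by linarith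
  have hσT : σ < τ + 1 := by linarith [min_le_right ε 1]
  have hπ : ∀ t ∈ Icc 0 σ, φ t ∈ Icc 0 Real.pi := by
    intro t ht
    refine ⟨h.phase_nonneg t ⟨ht.1, by linarith [ht.2]⟩, ?_⟩
    rcases lt_or_ge t τ with h1 | h1
    · linarith [hlt t ⟨ht.1, h1⟩, Real.pi_pos]
    · refine (hball ?_).le
      rw [Real.dist_eq, abs_of_nonneg (by linarith)]
      linarith [ht.2, min_le_left ε 1]
  have hIoo : ∀ t ∈ Icc (-σ) σ, t ∈ Ioo (-(τ + 1)) (τ + 1) :=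
    fun t ht => ⟨by linarith [ht.1], by linarith [ht.2]⟩
  have htr : ∀ t ∈ Icc (-σ) σ, truncate (-Real.pi) Real.pi (φ t) = φ t := by
    intro t ht
    refine truncate_of_mem ?_
    rcases le_total 0 t with h1 | h1
    · have := hπ t ⟨h1, ht.2⟩
      exact ⟨by linarith [this.1, Real.pi_pos], this.2⟩
    · have := hπ (-t) ⟨by linarith, by linarith [ht.1]⟩
      rw [h.phase_neg t (hIoo t ht)] at this
      exact ⟨by linarith [this.2], by linarith [this.1, Real.pi_pos]⟩
  refine ⟨σ, hστ, φ, z, ⟨fun t ht => ?_, fun t ht => ?_⟩, hφ, ?_, fun t ht => ?_⟩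
  · simpa only [htr t ht] using h.hasDerivAt_phase t (hIoo t ht)
  · simpa only [htr t ht] using h.hasDerivAt_log t (hIoo t ht)
  · rw [h.phase_neg τ hτT, hφ]
  · rcases le_total 0 t with h1 | h1
    · exact ⟨by linarith [(hπ t ⟨h1, by linarith [ht.2]⟩).1, Real.pi_pos], hlt t ⟨h1, ht.2⟩⟩
    · have h2 := hlt (-t) ⟨by linarith, by linarith [ht.1]⟩
      have h3 := (hπ (-t) ⟨by linarith, by linarith [ht.1]⟩).1
      rw [h.phase_neg t ⟨by linarith [ht.1], by linarith⟩] at h2 h3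
      exact ⟨by linarith, by linarith [Real.pi_pos]⟩

/-! ### Geometry of the wedge -/

theorem polarAngle_polar {r θ : ℝ} (hr : 0 < r) (h1 : -(Real.pi / 2) < θ) (h2 : θ < Real.pi / 2) :
    0 < r * Real.cos θ ∧ polarAngle !₂[r * Real.cos θ, r * Real.sin θ] = θ := by
  have hc : 0 < Real.cos θ := Real.cos_pos_of_mem_Ioo ⟨h1, h2⟩
  refine ⟨by positivity, ?_⟩
  simp only [polarAngle, Matrix.cons_val_zero, Matrix.cons_val_one]
  rw [mul_div_mul_left _ _ hr.ne', ← Real.tan_eq_sin_div_cos, Real.arctan_tan h1 h2]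

theorem eq_polar (hx : 0 < x 0) :
    x = !₂[√(x 0 ^ 2 + x 1 ^ 2) * Real.cos (polarAngle x),
      √(x 0 ^ 2 + x 1 ^ 2) * Real.sin (polarAngle x)] := by
  have hs : √(1 + (x 1 / x 0) ^ 2) = √(x 0 ^ 2 + x 1 ^ 2) / x 0 := by
    rw [show 1 + (x 1 / x 0) ^ 2 = (x 0 ^ 2 + x 1 ^ 2) / x 0 ^ 2 by field_simp,
      Real.sqrt_div' _ (by positivity), Real.sqrt_sq hx.le]
  have hN : 0 < √(x 0 ^ 2 + x 1 ^ 2) := Real.sqrt_pos.mpr (normSq_pos hx)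
  ext i
  fin_cases i
  · simp only [polarAngle, Real.cos_arctan, hs]
    simp
    field_simp
  · simp only [polarAngle, Real.sin_arctan, hs]
    simp
    field_simp

theorem wedge_eq_sector (hη : η < Real.pi) : wedge η = sector (Ioo (-(η / 2)) (η / 2)) := by
  ext x
  constructor
  · rintro ⟨r, θ, hr, h1, h2, rfl⟩
    obtain ⟨h3, h4⟩ := polarAngle_polar hr (by linarith : -(Real.pi / 2) < θ) (by linarith)
    exact ⟨by simpa using h3, by rw [h4]; exact ⟨h1, h2⟩⟩
  · intro hx
    exact ⟨_, _, Real.sqrt_pos.mpr (normSq_pos hx.1), hx.2.1, hx.2.2, eq_polar hx.1⟩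

theorem polarAngle_lt_iff (hx : 0 < x 0) (h1 : -(Real.pi / 2) < τ) (h2 : τ < Real.pi / 2) :
    polarAngle x < τ ↔ x 1 < x 0 * Real.tan τ := by
  rw [← div_lt_iff₀' hx, ← Real.arctan_strictMono.lt_iff_lt (b := Real.tan τ),
    Real.arctan_tan h1 h2]
  rfl

theorem lt_polarAngle_iff (hx : 0 < x 0) (h1 : -(Real.pi / 2) < τ) (h2 : τ < Real.pi / 2) :
    τ < polarAngle x ↔ x 0 * Real.tan τ < x 1 := by
  rw [← lt_div_iff₀' hx, ← Real.arctan_strictMono.lt_iff_lt (a := Real.tan τ),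
    Real.arctan_tan h1 h2]
  rfl

theorem mem_wedge_iff (hη₀ : 0 < η) (hη : η < Real.pi) :
    x ∈ wedge η ↔ x 1 < x 0 * Real.tan (η / 2) ∧ -x 1 < x 0 * Real.tan (η / 2) := by
  have ht : 0 < Real.tan (η / 2) := Real.tan_pos_of_pos_of_lt_pi_div_two (by linarith) (by linarith)
  have key : 0 < x 0 → (polarAngle x ∈ Ioo (-(η / 2)) (η / 2) ↔
      x 1 < x 0 * Real.tan (η / 2) ∧ -x 1 < x 0 * Real.tan (η / 2)) := by
    intro hx
    rw [mem_Ioo, lt_polarAngle_iff hx (by linarith) (by linarith),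
      polarAngle_lt_iff hx (by linarith) (by linarith), Real.tan_neg, mul_neg, neg_lt, and_comm]
  rw [wedge_eq_sector hη]
  constructor
  · exact fun h => (key h.1).mp h.2
  · intro h
    have hx : 0 < x 0 := pos_of_mul_pos_left (by linarith [h.1, h.2]) ht.le
    exact ⟨hx, (key hx).mpr h⟩

theorem convex_wedge (hη₀ : 0 < η) (hη : η < Real.pi) : Convex ℝ (wedge η) := by
  have h : wedge η = {x | x 1 - x 0 * Real.tan (η / 2) < 0} ∩
      {x | -x 1 - x 0 * Real.tan (η / 2) < 0} := by
    ext x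
    simp only [mem_wedge_iff hη₀ hη, mem_inter_iff, mem_ofPred_eq, sub_neg]
  rw [h]
  refine (convex_halfSpace_lt ⟨fun x y => ?_, fun c x => ?_⟩ 0).inter
    (convex_halfSpace_lt ⟨fun x y => ?_, fun c x => ?_⟩ 0) <;> simp <;> ring

theorem isOpen_wedge (hη : η < Real.pi) : IsOpen (wedge η) := by
  rw [wedge_eq_sector hη]
  exact isOpen_sector isOpen_Ioo

theorem single_mem_wedge (hη₀ : 0 < η) : EuclideanSpace.single 0 1 ∈ wedge η := by
  refine ⟨1, 0, one_pos, by linarith, by linarith, ?_⟩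
  ext i
  fin_cases i <;> simp

theorem mem_sector_of_mem_closure_wedge (hη₀ : 0 < η) (hη : η < Real.pi)
    (hx : x ∈ closure (wedge η)) (hx0 : x ≠ 0) : x ∈ sector (Icc (-(η / 2)) (η / 2)) := by
  have ht : 0 < Real.tan (η / 2) := Real.tan_pos_of_pos_of_lt_pi_div_two (by linarith) (by linarith)
  have hcl : closure (wedge η) ⊆ {x | x 1 ≤ x 0 * Real.tan (η / 2)} ∩
      {x | -x 1 ≤ x 0 * Real.tan (η / 2)} := by
    refine closure_minimal (fun y hy => ?_)
      ((isClosed_le (by fun_prop) (by fun_prop)).inter (isClosed_le (by fun_prop) (by fun_prop)))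
    have := (mem_wedge_iff hη₀ hη).mp hy
    exact ⟨this.1.le, this.2.le⟩
  obtain ⟨h1, h2⟩ := hcl hx
  simp only [mem_ofPred_eq] at h1 h2
  have hpos : 0 < x 0 := by
    rcases lt_trichotomy (x 0) 0 with h | h | h
    · nlinarith
    · exfalso
      rw [h] at h1 h2
      refine hx0 ?_
      ext i
      fin_cases i
      · simpa using h
      · simp
        linarith
    · exact h
  refine ⟨hpos, ?_, ?_⟩
  · rw [← not_lt, polarAngle_lt_iff hpos (by linarith) (by linarith), Real.tan_neg]
    linarith
  · rw [← not_lt, lt_polarAngle_iff hpos (by linarith) (by linarith)]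
    linarith

theorem polarAngle_zero : polarAngle 0 = 0 := by simp [polarAngle]

theorem polarAngle_mem_of_mem_closure_wedge (hη₀ : 0 < η) (hη : η < Real.pi)
    (hx : x ∈ closure (wedge η)) : polarAngle x ∈ Icc (-(η / 2)) (η / 2) := by
  rcases eq_or_ne x 0 with rfl | h0
  · rw [polarAngle_zero]
    exact ⟨by linarith, by linarith⟩
  · exact (mem_sector_of_mem_closure_wedge hη₀ hη hx h0).2

theorem uniqueDiffWithinAt_closure_wedge (hη₀ : 0 < η) (hη : η < Real.pi)
    (hx : x ∈ closure (wedge η) \ {0}) : UniqueDiffWithinAt ℝ (closure (wedge η) \ {0}) x := by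
  have h := uniqueDiffOn_convex (convex_wedge hη₀ hη).closure
    ⟨_, (isOpen_wedge hη).subset_interior_iff.mpr subset_closure (single_mem_wedge hη₀)⟩ x hx.1
  rw [sdiff_eq]
  exact h.inter (isOpen_compl_singleton.mem_nhds hx.2)

/-- The function `r² f(θ)` is continuous at the vertex of the wedge when `f` is continuous on the
closed interval of angles. -/
theorem continuousWithinAt_twoHomogeneous_zero (hη₀ : 0 < η) (hη : η < Real.pi) {f : ℝ → ℝ}
    (hf : ContinuousOn f (Icc (-(η / 2)) (η / 2))) :
    ContinuousWithinAt (twoHomogeneous f) (closure (wedge η)) 0 := by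
  obtain ⟨C, hC⟩ := isCompact_Icc.exists_bound_of_continuousOn hf
  have h0 : twoHomogeneous f 0 = 0 := by simp [twoHomogeneous]
  rw [ContinuousWithinAt, h0]
  refine squeeze_zero_norm' (a := fun y : EuclideanSpace ℝ (Fin 2) => (y 0 ^ 2 + y 1 ^ 2) * C) ?_ ?_
  · filter_upwards [self_mem_nhdsWithin] with y hy
    rw [twoHomogeneous, norm_mul, Real.norm_of_nonneg (by positivity)]
    exact mul_le_mul_of_nonneg_left (hC _ (polarAngle_mem_of_mem_closure_wedge hη₀ hη hy))
      (by positivity)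
  · have hc : Continuous fun y : EuclideanSpace ℝ (Fin 2) => (y 0 ^ 2 + y 1 ^ 2) * C := by fun_prop
    simpa using hc.continuousWithinAt.tendsto (s := closure (wedge η)) (x := 0)

/-- The critical half-angle in terms of the value at `π/2` of the primitive that describes the
`p`-harmonic profile. -/
theorem critical_angle_eq (hp : 1 < p) :
    Real.pi / 2 - (p - 1) * (Real.pi / 2 / √(p * (2 * (p - 1)))) =
      Real.pi * (1 - 1 / 2 * √(2 * (p - 1) / p)) / 2 := by
  have hp0 : 0 < p := by linarith
  have hq : 0 < 2 * (p - 1) / p := div_pos (by linarith) hp0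
  have ha : 0 < √(2 * (p - 1) / p) := Real.sqrt_pos.mpr hq
  have hsq := Real.sq_sqrt hq.le
  have h1 : √(p * (2 * (p - 1))) = p * √(2 * (p - 1) / p) := by
    rw [show p * (2 * (p - 1)) = p ^ 2 * (2 * (p - 1) / p) by field_simp,
      Real.sqrt_mul (by positivity), Real.sqrt_sq hp0.le]
  rw [h1]
  set a := √(2 * (p - 1) / p)
  have h2 : p - 1 = p * a ^ 2 / 2 := by rw [hsq]; field_simp
  rw [h2]
  field_simp

end

theorem theorem1p2 (p η : ℝ) (hp : 1 < p) (hη₀ : 0 < η)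
    (hη : η < Real.pi * (1 - 1 / 2 * Real.sqrt (2 * (p - 1) / p))) :
    ∃ (u : EuclideanSpace ℝ (Fin 2) → ℝ) (f : ℝ → ℝ),
      -- the form `u = r² f(θ)` on the closed wedge
      (∀ r θ : ℝ, 0 ≤ r → -(η / 2) ≤ θ → θ ≤ η / 2 →
        u !₂[r * Real.cos θ, r * Real.sin θ] = r ^ 2 * f θ) ∧
      -- regularity
      ExtendsContDiff 3 u (closure (wedge η) \ {0}) ∧
      ContinuousOn u (closure (wedge η)) ∧
      -- the boundary value problem
      (∀ x ∈ wedge η, gamePLaplacian p u x = -1) ∧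
      (∀ x ∈ frontier (wedge η), u x = 0) ∧
      -- signs
      (∀ x ∈ closure (wedge η), 0 ≤ u x) ∧
      (∀ x ∈ wedge η, 0 < u x) ∧
      -- the gradient, one-sided at the boundary, does not vanish away from the origin
      (∀ x ∈ closure (wedge η) \ {0},
        gradientWithin u (closure (wedge η) \ {0}) x ≠ 0) := by
  have hηπ : η < Real.pi := by
    have : 0 ≤ √(2 * (p - 1) / p) := Real.sqrt_nonneg _
    nlinarith [Real.pi_pos]
  obtain ⟨σ, hσ, φ, z, h, hφ, hφ', hlt⟩ := exists_phaseSolution hp (half_pos hη₀)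
    (by rw [critical_angle_eq hp]; linarith : η / 2 < _)
  set f := angularProfile φ z
  have hI : Icc (-(η / 2)) (η / 2) ⊆ Ioo (-σ) σ :=
    fun t ht => ⟨by linarith [ht.1], by linarith [ht.2]⟩
  have hsol : IsPhaseSolution p (Ioo (-σ) σ) φ z := h.mono Ioo_subset_Icc_self
  have hsub : ∀ x ∈ closure (wedge η) \ {0}, x ∈ sector (Ioo (-σ) σ) := fun x hx =>
    have hx' := mem_sector_of_mem_closure_wedge hη₀ hηπ hx.1 hx.2
    ⟨hx'.1, hI hx'.2⟩
  have hsmooth := h.contDiffOn_twoHomogeneous hp 3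
  have hopen : IsOpen (sector (Ioo (-σ) σ)) := isOpen_sector isOpen_Ioo
  have hfpos : ∀ t ∈ Ioo (-(η / 2)) (η / 2), 0 < f t := fun t ht => by
    have := Real.cos_pos_of_mem_Ioo (hlt t ht)
    simp only [f, angularProfile]
    positivity
  have hfend : f (η / 2) = 0 ∧ f (-(η / 2)) = 0 := by simp [f, angularProfile, hφ, hφ']
  have hfnonneg : ∀ t ∈ Icc (-(η / 2)) (η / 2), 0 ≤ f t := fun t ht => by
    rcases eq_endpoints_or_mem_Ioo_of_mem_Icc ht with rfl | rfl | h'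
    · exact hfend.2.ge
    · exact hfend.1.ge
    · exact (hfpos t h').le
  refine ⟨twoHomogeneous f, f, fun r θ hr h1 h2 => ?_, ?_, fun x hx => ?_, fun x hx => ?_,
    fun x hx => ?_, fun x hx => ?_, fun x hx => ?_, fun x hx => ?_⟩
  · rcases hr.eq_or_lt with rfl | hr
    · simp [twoHomogeneous]
    · rw [twoHomogeneous, (polarAngle_polar hr (by linarith) (by linarith)).2]
      simp only [Matrix.cons_val_zero, Matrix.cons_val_one]
      linear_combination r ^ 2 * f θ * Real.sin_sq_add_cos_sq θ
  · exact ⟨_, _, hopen, hsub, by exact_mod_cast hsmooth, fun _ _ => rfl⟩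
  · rcases eq_or_ne x 0 with rfl | hx0
    · exact continuousWithinAt_twoHomogeneous_zero hη₀ hηπ
        ((h.contDiffOn_angularProfile hp 0).continuousOn.mono (hI.trans Ioo_subset_Icc_self))
    · exact (hsmooth.continuousOn.continuousAt
        (hopen.mem_nhds (hsub x ⟨hx, hx0⟩))).continuousWithinAt
  · rw [wedge_eq_sector hηπ] at hx
    exact hsol.gamePLaplacian_eq hp isOpen_Ioo ⟨hx.1, hI (Ioo_subset_Icc_self hx.2)⟩
  · rw [(isOpen_wedge hηπ).frontier_eq] at hx
    rcases eq_or_ne x 0 with rfl | hx0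
    · simp [twoHomogeneous]
    · have hx' := mem_sector_of_mem_closure_wedge hη₀ hηπ hx.1 hx0
      have hnot := hx.2
      rw [wedge_eq_sector hηπ] at hnot
      rw [twoHomogeneous]
      rcases eq_endpoints_or_mem_Ioo_of_mem_Icc hx'.2 with he | he | he
      · rw [he, hfend.2, mul_zero]
      · rw [he, hfend.1, mul_zero]
      · exact absurd ⟨hx'.1, he⟩ hnot
  · exact mul_nonneg (by positivity)
      (hfnonneg _ (polarAngle_mem_of_mem_closure_wedge hη₀ hηπ hx))
  · rw [wedge_eq_sector hηπ] at hx
    exact mul_pos (normSq_pos hx.1) (hfpos _ hx.2)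
  · have hd := (hsol.hasGradientAt hp (hsub x hx)).differentiableAt
    rw [gradientWithin, hd.fderivWithin (uniqueDiffWithinAt_closure_wedge hη₀ hηπ hx)]
    exact hsol.gradient_ne_zero hp (hsub x hx)
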